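/- Let $0<\alpha<1$ and $0\le\beta<1$, and consider $x_{n+1}=\alpha+\beta x_{n-1}+\dfrac{x_{n-1}}{x_n}$, that is, the planar map $T(x,y)=\bigl(y,\ \alpha+\beta x+\tfrac{x}{y}\bigr)$ acting on $(x,y)=(x_{n-1},x_n)$. Put $$\bar x=\frac{1+\alpha}{1-\beta},\qquad \theta=\sqrt{1+4\bar x+4\beta\bar x^2},\qquad \lambda_1=\frac{-1-\theta}{2\bar x},\qquad \lambda_2=\frac{-1+\theta}{2\bar x},$$ $$\mathbf v_1=\Bigl(\frac{-2\bar x}{1+\theta},1\Bigr),\quad \mathbf v_2=\Bigl(\frac{-2\bar x}{1-\theta},1\Bigr),\quad \gamma_1=\frac{1+\beta\bar x}{-\theta},\quad \gamma_2=\frac{\theta-1}{2\theta},\quad \gamma_3=\frac{\theta+1}{2\theta},$$ $$a_2=\frac{1+\theta+2\beta\bar x}{\theta(\theta+1)(\lambda_1^2-\lambda_2)\bar x},\qquad a_3=\frac{a_2}{(\lambda_1^3-\lambda_2)\bar x}\left[\lambda_2-\lambda_1^2-\frac{1+2\beta\bar x}{\theta\bar x}\Bigl(\frac1{\lambda_1}+\frac{\lambda_1}{\lambda_2}\Bigr)-\frac{\lambda_1}{\lambda_2\bar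 x}\right],$$ $$U(x,y)=\gamma_1(x-\bar x)-\gamma_2(y-\bar x)+a_2\bigl[\gamma_1(x-\bar x)+\gamma_3(y-\bar x)\bigr]^2+a_3\bigl[\gamma_1(x-\bar x)+\gamma_3(y-\bar x)\bigr]^3,$$ $$f(\xi,\eta)=\frac{(1+2\beta\bar x)(\xi+\eta)^2+\theta(\xi^2-\eta^2)}{\theta(\theta-1)(\xi+\eta+\bar x)},\qquad g(\xi,\eta)=\frac{(1+2\beta\bar x)(\xi+\eta)^2+\theta(\xi^2-\eta^2)}{\theta(\theta+1)(\xi+\eta+\bar x)}.$$ For a neighborhood $N$ of $(\bar x,\bar x)$ on which $T$ is injective, let the local unstable manifold $W^u(N)$ be the set of points $p\in N$ such that $T^{-n}(p)$ is defined and lies in $N$ for all $n\ge0$ and $T^{-n}(p)\to(\bar x,\bar x)$ as $n\to\infty$, where $T^{-1}$ is the inverse of $T|_N$. Then $(\bar x,\bar x)$ is a saddle fixed point of $T$: the derivative $DT(\bar x,\bar x)$ has the eigenvectors $\mathbf v_1,\mathbf v_2$ with eigenvalues $\lambda_1,\lambda_2$, where $|\lambda_1|>1$ and $0<|\lambda_2|<1$.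 Moreover, there are real functions $\varphi$ (near $0$), $\Phi$ and $\tilde\varphi$ (near $\bar x$) with the following properties. 1. There is a neighborhood $N_0$ of $(\bar x,\bar x)$ on which $T$ is injective such that, for every neighborhood $N\subseteq N_0$ of $(\bar x,\bar x)$: for all $(\xi,\eta)$ sufficiently close to $(0,0)$, the point $(\bar x,\bar x)+\xi\mathbf v_1+\eta\mathbf v_2$ belongs to $W^u(N)$ if and only if $\eta=\varphi(\xi)$; and for all $(x,y)$ sufficiently close to $(\bar x,\bar x)$, the point $(x,y)$ belongs to $W^u(N)$ if and only if $y=\Phi(x)$. 2. $\varphi$ is analytic at $0$, $\varphi(0)=\varphi'(0)=0$, it satisfies the invariance equation $\varphi(\lambda_1\xi+f(\xi,\varphi(\xi)))=\lambda_2\varphi(\xi)+g(\xi,\varphi(\xi))$ for all $\xi$ near $0$, and $\varphi(\xi)=a_2\xi^2+a_3\xi^3+O(\xi^4)$ as $\xi\to0$. 3. For all $(x,y)$ sufficiently close to $(\bar x,\bar x)$, $U(x,y)=0$ if and only if $y=\tilde\varphi(x)$; and $\tilde\varphi(\bar x)=\bar x$, $\tilde\varphi'(\bar x)=-\dfrac{1+\theta}{2\bar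 x}$. 4. The curve $U(x,\tilde\varphi(x))=0$ approximates the local unstable manifold up to cubic order: $\Phi(x)-\tilde\varphi(x)=O\bigl((x-\bar x)^4\bigr)$ as $x\to\bar x$. -/

import Mathlib

open Filter Topology Asymptotics

noncomputable section

/-- The planar map of the recursion `x_{n+1} = α + β x_{n-1} + x_{n-1} / x_n`, acting on
`(x_{n-1}, x_n)`. -/
def ratMap (α β : ℝ) (p : ℝ × ℝ) : ℝ × ℝ :=
  (p.2, α + β * p.1 + p.1 / p.2)

/-- The equilibrium. -/
def xbar (α β : ℝ) : ℝ := (1 + α) / (1 - β)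

/-- The square root of the discriminant of the linearization. -/
def theta (α β : ℝ) : ℝ := Real.sqrt (1 + 4 * xbar α β + 4 * β * xbar α β ^ 2)

/-- The unstable eigenvalue. -/
def eigOne (α β : ℝ) : ℝ := (-1 - theta α β) / (2 * xbar α β)

/-- The stable eigenvalue. -/
def eigTwo (α β : ℝ) : ℝ := (-1 + theta α β) / (2 * xbar α β)

/-- The eigenvector for `eigOne`. -/
def vecOne (α β : ℝ) : ℝ × ℝ := (-2 * xbar α β / (1 + theta α β), 1)

/-- The eigenvector for `eigTwo`. -/
def vecTwo (α β : ℝ) : ℝ × ℝ := (-2 * xbar α β / (1 - theta α β), 1)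

/-- The point of the `(x_{n-1}, x_n)`-plane with eigen-coordinates `(ξ, η)` about the fixed
point. -/
def eigPoint (α β ξ η : ℝ) : ℝ × ℝ :=
  (xbar α β, xbar α β) + ξ • vecOne α β + η • vecTwo α β

/-- The nonlinear term of the first component of the normal form. -/
def nfF (α β ξ η : ℝ) : ℝ :=
  ((1 + 2 * β * xbar α β) * (ξ + η) ^ 2 + theta α β * (ξ ^ 2 - η ^ 2)) /
    (theta α β * (theta α β - 1) * (ξ + η + xbar α β))

/-- The nonlinear term of the second component of the normal form. -/
def nfG (α β ξ η : ℝ) : ℝ :=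
  ((1 + 2 * β * xbar α β) * (ξ + η) ^ 2 + theta α β * (ξ ^ 2 - η ^ 2)) /
    (theta α β * (theta α β + 1) * (ξ + η + xbar α β))

/-- The quadratic coefficient. -/
def coefTwo (α β : ℝ) : ℝ :=
  (1 + theta α β + 2 * β * xbar α β) /
    (theta α β * (theta α β + 1) * (eigOne α β ^ 2 - eigTwo α β) * xbar α β)

/-- The cubic coefficient. -/
def coefThree (α β : ℝ) : ℝ :=
  coefTwo α β / ((eigOne α β ^ 3 - eigTwo α β) * xbar α β) *
    (eigTwo α β - eigOne α β ^ 2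
      - (1 + 2 * β * xbar α β) / (theta α β * xbar α β) *
          (1 / eigOne α β + eigOne α β / eigTwo α β)
      - eigOne α β / (eigTwo α β * xbar α β))

def gammaOne (α β : ℝ) : ℝ := (1 + β * xbar α β) / (-theta α β)

def gammaTwo (α β : ℝ) : ℝ := (theta α β - 1) / (2 * theta α β)

def gammaThree (α β : ℝ) : ℝ := (theta α β + 1) / (2 * theta α β)

/-- The cubic polynomial `U(x, y)`. -/
def cubicU (α β x y : ℝ) : ℝ :=
  gammaOne α β * (x - xbar α β) - gammaTwo α β * (y - xbar α β)
    + coefTwo α β * (gammaOne α β * (x - xbar α β) + gammaThree α β * (y - xbar α β)) ^ 2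
    + coefThree α β * (gammaOne α β * (x - xbar α β) + gammaThree α β * (y - xbar α β)) ^ 3

/-- `p` is a hyperbolic saddle fixed point of the planar map `F`: the derivative at `p` has the
eigenvector `v` with eigenvalue `μ` outside the unit circle, and the eigenvector `w` with nonzero
eigenvalue `ν` inside the unit circle. -/
def IsSaddle (F : ℝ × ℝ → ℝ × ℝ) (p : ℝ × ℝ) (μ : ℝ) (v : ℝ × ℝ) (ν : ℝ) (w : ℝ × ℝ) : Prop :=
  Function.IsFixedPt F p ∧ DifferentiableAt ℝ F p ∧
    Module.End.HasEigenvector (fderiv ℝ F p : (ℝ × ℝ) →ₗ[ℝ] (ℝ × ℝ)) μ v ∧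
    Module.End.HasEigenvector (fderiv ℝ F p : (ℝ × ℝ) →ₗ[ℝ] (ℝ × ℝ)) ν w ∧
    1 < |μ| ∧ 0 < |ν| ∧ |ν| < 1

/-- The local unstable manifold of the fixed point `c` of `F` in `N`: the points of `N` having a
backward orbit that stays in `N` and converges to `c`. Where `F` is injective on `N`, the backward
orbit is unique: it is the sequence of the points `F⁻ⁿ(p)`. -/
def localUnstable (F : ℝ × ℝ → ℝ × ℝ) (c : ℝ × ℝ) (N : Set (ℝ × ℝ)) : Set (ℝ × ℝ) :=
  {p | ∃ q : ℕ → ℝ × ℝ, q 0 = p ∧ (∀ n, q n ∈ N) ∧ (∀ n, F (q (n + 1)) = q n) ∧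
    Tendsto q atTop (𝓝 c)}

end

/-! The unstable curve is constructed from its linearizing parametrization. Write X for the fixed
point coordinate, l and m for the unstable and stable eigenvalues. One seeks orbits `x_n = X + w(lⁿ
s)` with `w` analytic and `w'(0) = 1`. Clearing the denominator in the recursion gives a quadratic
functional equation for `w`; since `|m| < 1 < |l|` there are no small divisors, and a Catalan
majorant yields convergence (`exists_analytic_conjugacy`).

In eigen-coordinates the curve `(X + w(s), X + w(l s))` is tangent to the unstable direction, so it
is the graph of an analytic `φ`, and invariance of the curve is the invariance equation. The graph
is the local unstable manifold for two reasons. The map contracts the deviation `η - φ(ξ)`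
(`eventually_abs_deviation_le`), so a backward orbit converging to the fixed point must have
deviation zero; conversely, a point of the curve has the backward orbit with parameters `s / lⁿ`.

Matching Taylor coefficients in the invariance equation gives `a₂` and `a₃`. Since `-U` is `η - a₂ξ²
- a₃ξ³`, the curve `U = 0` has contact of order four with the graph of `φ`, and the implicit
function theorem carries this contact over to graphs over `x`. -/

/-! ### Catalan majorants and the analytic conjugacy equation -/

/-- The sequence defined by the quadratic convolution recursion with kernel `κ`, started at `1`. -/
def quadSeq (κ : ℕ → ℕ → ℝ) : ℕ → ℝ
  | 0 => 1
  | n + 1 => ∑ i : Fin n.succ, κ i (n - i) * quadSeq κ i * quadSeq κ (n - i)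

theorem quadSeq_zero (κ : ℕ → ℕ → ℝ) : quadSeq κ 0 = 1 := by rw [quadSeq]

theorem quadSeq_succ (κ : ℕ → ℕ → ℝ) (n : ℕ) :
    quadSeq κ (n + 1) =
      ∑ ij ∈ Finset.HasAntidiagonal.antidiagonal n, κ ij.1 ij.2 * quadSeq κ ij.1 * quadSeq κ ij.2 := by
  rw [quadSeq, Finset.Nat.sum_antidiagonal_eq_sum_range_succ_mk, Finset.sum_range]

theorem catalan_le_four_pow (n : ℕ) : catalan n ≤ 4 ^ n := by
  rw [catalan_eq_centralBinom_div]
  calc n.centralBinom / (n + 1) ≤ n.centralBinom := Nat.div_le_self _ _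
    _ ≤ 2 ^ (2 * n) := by rw [Nat.centralBinom_eq_two_mul_choose]; exact Nat.choose_le_two_pow _ _
    _ = 4 ^ n := by rw [pow_mul]; norm_num

/-- The Catalan numbers solve the same convolution recursion with kernel one, and each application
of the recursion costs one factor `C`. -/
theorem abs_quadSeq_le_catalan {κ : ℕ → ℕ → ℝ} {C : ℝ} (hκ : ∀ i j, |κ i j| ≤ C) (n : ℕ) :
    |quadSeq κ n| ≤ C ^ n * catalan n := by
  have hC : 0 ≤ C := (abs_nonneg _).trans (hκ 0 0)
  induction n using Nat.strong_induction_on with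
  | _ n ih =>
    cases n with
    | zero => simp [quadSeq_zero]
    | succ n =>
      rw [quadSeq_succ, catalan_succ']
      push_cast
      rw [Finset.mul_sum]
      refine (Finset.abs_sum_le_sum_abs _ _).trans (Finset.sum_le_sum fun ij hij => ?_)
      have hn := Finset.HasAntidiagonal.mem_antidiagonal.mp hij
      rw [abs_mul, abs_mul]
      calc |κ ij.1 ij.2| * |quadSeq κ ij.1| * |quadSeq κ ij.2|
          ≤ C * (C ^ ij.1 * catalan ij.1) * (C ^ ij.2 * catalan ij.2) := by
            gcongr
            · exact hκ _ _
            · exact ih _ (by omega)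
            · exact ih _ (by omega)
        _ = C ^ (n + 1) * (catalan ij.1 * catalan ij.2) := by
            rw [← hn]; ring

theorem abs_quadSeq_le {κ : ℕ → ℕ → ℝ} {C : ℝ} (hκ : ∀ i j, |κ i j| ≤ C) (n : ℕ) :
    |quadSeq κ n| ≤ (4 * C) ^ n := by
  have hC : 0 ≤ C := (abs_nonneg _).trans (hκ 0 0)
  calc |quadSeq κ n| ≤ C ^ n * catalan n := abs_quadSeq_le_catalan hκ n
    _ ≤ C ^ n * 4 ^ n := by gcongr; exact_mod_cast catalan_le_four_pow n
    _ = (4 * C) ^ n := by rw [mul_pow]; ring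

theorem summable_norm_mul_pow_of_abs_le {a : ℕ → ℝ} {K s : ℝ} (ha : ∀ n, |a n| ≤ K ^ n)
    (hs : K * |s| < 1) : Summable fun n => ‖a n * s ^ n‖ := by
  have hK : 0 ≤ K := by simpa using (abs_nonneg _).trans (ha 1)
  refine Summable.of_nonneg_of_le (fun _ => norm_nonneg _) (fun n => ?_)
    (summable_geometric_of_lt_one (by positivity) hs)
  rw [norm_mul, norm_pow, mul_pow, Real.norm_eq_abs, Real.norm_eq_abs]
  gcongr
  exact ha n

theorem analyticAt_tsum_mul_pow {a : ℕ → ℝ} {K : ℝ} (ha : ∀ n, |a n| ≤ K ^ n) :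
    AnalyticAt ℝ (fun s => ∑' n, a n * s ^ n) 0 := by
  have hK : 0 ≤ K := by simpa using (abs_nonneg _).trans (ha 1)
  refine ⟨FormalMultilinearSeries.ofScalars ℝ a, ?_⟩
  rw [hasFPowerSeriesAt_iff]
  have h : ∀ᶠ s : ℝ in 𝓝 0, K * |s| < 1 := by
    have : Tendsto (fun s : ℝ => K * |s|) (𝓝 0) (𝓝 (K * |0|)) := by
      exact (continuous_const.mul continuous_abs).tendsto _
    exact this.eventually_lt_const (by simp)
  filter_upwards [h] with s hs
  have := (summable_norm_mul_pow_of_abs_le ha hs).of_norm.hasSum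
  simpa [FormalMultilinearSeries.coeff_ofScalars, mul_comm] using this

/-- An analytic solution, tangent to the identity, of the conjugacy equation for the
parametrization of an unstable curve. -/
theorem exists_analytic_conjugacy {X β l m : ℝ} (hX : 0 < X) (hβ0 : 0 ≤ β) (hβ1 : β < 1)
    (hl : 1 < |l|) (hm : |m| < 1)
    (hchar : ∀ t, X * ((t - l) * (t - m)) = X * t ^ 2 + t - (1 + β * X)) :
    ∃ w : ℝ → ℝ, AnalyticAt ℝ w 0 ∧ w 0 = 0 ∧ HasDerivAt w 1 0 ∧
      ∀ᶠ s in 𝓝 (0 : ℝ), X * w (l ^ 2 * s) + w (l * s) - (1 + β * X) * w s =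
        w (l * s) * (β * w s - w (l ^ 2 * s)) := by
  -- For `w(s) = ∑ aₙ sⁿ⁺¹`, the linear side multiplies the coefficient of `sⁿ` by `d n`, and `e i
  -- j` is the weight of `aᵢ aⱼ` on the quadratic side. As `d 1 = 0`, the leading coefficient is
  -- free and is normalized to one; the others are forced.
  set d : ℕ → ℝ := fun n => X * ((l ^ n - l) * (l ^ n - m)) with hd
  set e : ℕ → ℕ → ℝ := fun i j => l ^ (j + 1) * (β - l ^ (2 * (i + 1))) with he
  set κ : ℕ → ℕ → ℝ := fun i j => e i j / d (i + j + 2) with hκdef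
  set c : ℝ := X * ((1 - 1 / |l|) * (1 - |m|)) with hc
  have hl0 : 0 < |l| := by linarith
  have h1l : 0 < 1 - 1 / |l| := by
    rw [sub_pos, div_lt_one hl0]; exact hl
  have hcpos : 0 < c := mul_pos hX (mul_pos h1l (by linarith))
  -- Each of the two factors of `d` is at least a fixed fraction of `|l|ⁿ⁺²`; the product of the
  -- fractions, times `X`, is `c`.
  have hdlow : ∀ n, c * |l| ^ (2 * (n + 2)) ≤ |d (n + 2)| := by
    intro n
    have e1 : |l| ^ (n + 2) * (1 - 1 / |l|) ≤ |l ^ (n + 2) - l| := by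
      have := abs_sub_abs_le_abs_sub (l ^ (n + 2)) l
      rw [abs_pow] at this
      refine le_trans ?_ this
      have : |l| ^ (n + 2) * (1 - 1 / |l|) = |l| ^ (n + 2) - |l| ^ (n + 1) := by
        field_simp; ring
      rw [this]
      have : |l| ≤ |l| ^ (n + 1) := le_self_pow₀ hl.le (by omega)
      linarith
    have e2 : |l| ^ (n + 2) * (1 - |m|) ≤ |l ^ (n + 2) - m| := by
      have := abs_sub_abs_le_abs_sub (l ^ (n + 2)) m
      rw [abs_pow] at this
      refine le_trans ?_ this
      have h1 : 1 ≤ |l| ^ (n + 2) := one_le_pow₀ hl.le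
      nlinarith [abs_nonneg m]
    simp only [hd]
    rw [abs_mul, abs_mul, abs_of_pos hX]
    calc c * |l| ^ (2 * (n + 2))
        = X * ((|l| ^ (n + 2) * (1 - 1 / |l|)) * (|l| ^ (n + 2) * (1 - |m|))) := by
          rw [hc, two_mul, pow_add]; ring
      _ ≤ _ := by
          gcongr
  have hdpos : ∀ n, 0 < |d (n + 2)| := fun n => lt_of_lt_of_le (by positivity) (hdlow n)
  have heup : ∀ i j, |e i j| ≤ 2 * |l| ^ (2 * (i + j + 2)) := by
    intro i j
    simp only [he]
    rw [abs_mul, abs_pow]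
    have h1 : |β - l ^ (2 * (i + 1))| ≤ 2 * |l| ^ (2 * (i + 1)) := by
      have h2 : 1 ≤ |l| ^ (2 * (i + 1)) := one_le_pow₀ hl.le
      have := abs_sub β (l ^ (2 * (i + 1)))
      rw [abs_pow, abs_of_nonneg hβ0] at this
      linarith
    calc |l| ^ (j + 1) * |β - l ^ (2 * (i + 1))|
        ≤ |l| ^ (2 * (j + 1)) * (2 * |l| ^ (2 * (i + 1))) := by
          gcongr
          · exact hl.le
          · omega
      _ = _ := by ring
  -- Numerator and denominator both have size `|l|` to the power `2(i + j + 2)`, so the kernel is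
  -- bounded.
  have hκ : ∀ i j, |κ i j| ≤ 2 / c := by
    intro i j
    simp only [hκdef]
    rw [abs_div, div_le_div_iff₀ (hdpos _) hcpos]
    nlinarith [heup i j, hdlow (i + j)]
  set a := quadSeq κ with ha
  set K := 4 * (2 / c) with hK
  have hK0 : 0 < K := by positivity
  have habs : ∀ n, |a n| ≤ K ^ n := abs_quadSeq_le hκ
  set A : ℝ → ℝ := fun s => ∑' n, a n * s ^ n with hA
  have hAan : AnalyticAt ℝ A 0 := analyticAt_tsum_mul_pow habs
  have hA0 : A 0 = 1 := by
    simp only [hA]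
    rw [tsum_eq_single 0 (by intro n hn; simp [hn])]
    simp [ha, quadSeq_zero]
  refine ⟨fun s => s * A s, analyticAt_id.mul hAan, by simp, ?_, ?_⟩
  · have := (hasDerivAt_id (0 : ℝ)).mul hAan.differentiableAt.hasDerivAt
    simpa [hA0] using! this
  have hev : ∀ᶠ s : ℝ in 𝓝 0, K * |l ^ 2 * s| < 1 := by
    have : Tendsto (fun s : ℝ => K * |l ^ 2 * s|) (𝓝 0) (𝓝 (K * |l ^ 2 * 0|)) :=
      (Continuous.tendsto (by fun_prop) _)
    exact this.eventually_lt_const (by simp)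
  filter_upwards [hev] with s hs2
  have hs1 : K * |l * s| < 1 := by
    refine lt_of_le_of_lt ?_ hs2
    rw [abs_mul, abs_mul, abs_pow]
    gcongr
    exact le_self_pow₀ hl.le (by norm_num)
  have hs0 : K * |s| < 1 := by
    refine lt_of_le_of_lt ?_ hs1
    rw [abs_mul]
    gcongr
    exact le_mul_of_one_le_left (abs_nonneg _) hl.le
  have S0 := summable_norm_mul_pow_of_abs_le habs hs0
  have S1 := summable_norm_mul_pow_of_abs_le habs hs1
  have S2 := summable_norm_mul_pow_of_abs_le habs hs2
  have H0 : HasSum (fun n => a n * s ^ n) (A s) := S0.of_norm.hasSum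
  have H1 : HasSum (fun n => a n * (l * s) ^ n) (A (l * s)) := S1.of_norm.hasSum
  have H2 : HasSum (fun n => a n * (l ^ 2 * s) ^ n) (A (l ^ 2 * s)) := S2.of_norm.hasSum
  -- the linear part, as a series whose constant term vanishes
  have HL : HasSum (fun n => d (n + 1) * a n * s ^ n)
      (X * l ^ 2 * A (l ^ 2 * s) + l * A (l * s) - (1 + β * X) * A s) := by
    convert! ((H2.mul_left (X * l ^ 2)).add (H1.mul_left l)).sub (H0.mul_left (1 + β * X))
      using 2 with n
    simp only [hd]
    rw [hchar]
    ring
  -- The constant term drops out because `d 1 = 0`, which aligns the indices with the recursion for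
  -- `a (n + 1)`.
  have HL' : HasSum (fun n => d (n + 2) * a (n + 1) * s ^ (n + 1))
      (X * l ^ 2 * A (l ^ 2 * s) + l * A (l * s) - (1 + β * X) * A s) := by
    have := (hasSum_nat_add_iff' 1).mpr HL
    simpa [hd] using this
  have P0 := tsum_mul_tsum_eq_tsum_sum_antidiagonal_of_summable_norm S0 S1
  have P2 := tsum_mul_tsum_eq_tsum_sum_antidiagonal_of_summable_norm S2 S1
  have Q0 := (summable_norm_sum_mul_antidiagonal_of_summable_norm S0 S1).of_norm.hasSum
  have Q2 := (summable_norm_sum_mul_antidiagonal_of_summable_norm S2 S1).of_norm.hasSum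
  rw [← P0] at Q0
  rw [← P2] at Q2
  have HR : HasSum (fun n => d (n + 2) * a (n + 1) * s ^ n)
      (β * l * (A s * A (l * s)) - l ^ 3 * (A (l ^ 2 * s) * A (l * s))) := by
    convert! (Q0.mul_left (β * l)).sub (Q2.mul_left (l ^ 3)) using 2 with n
    rw [ha, quadSeq_succ, Finset.mul_sum, Finset.sum_mul, Finset.mul_sum, Finset.mul_sum,
      ← Finset.sum_sub_distrib]
    refine Finset.sum_congr rfl fun ij hij => ?_
    have hn := Finset.HasAntidiagonal.mem_antidiagonal.mp hij
    have hne : d (n + 2) ≠ 0 := abs_pos.mp (hdpos n)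
    have hs : s ^ n = s ^ ij.1 * s ^ ij.2 := by rw [← hn, pow_add]
    have hdκ : d (n + 2) * κ ij.1 ij.2 = e ij.1 ij.2 := by
      simp only [hκdef]
      rw [hn]
      field_simp
    rw [hs]
    generalize quadSeq κ ij.1 = a₁
    generalize quadSeq κ ij.2 = a₂
    calc d (n + 2) * (κ ij.1 ij.2 * a₁ * a₂) * (s ^ ij.1 * s ^ ij.2)
        = (d (n + 2) * κ ij.1 ij.2) * a₁ * a₂ * (s ^ ij.1 * s ^ ij.2) := by ring
      _ = _ := by rw [hdκ]; simp only [he]; ring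
  have HR' : HasSum (fun n => d (n + 2) * a (n + 1) * s ^ (n + 1))
      (s * (β * l * (A s * A (l * s)) - l ^ 3 * (A (l ^ 2 * s) * A (l * s)))) := by
    convert! HR.mul_left s using 2 with n
    ring
  have := HL'.unique HR'
  linear_combination s * this

/-! ### Eigenvalues, eigen-coordinates and the saddle property -/

section Basic

variable {α β : ℝ}

theorem xbar_pos (hα0 : 0 < α) (hβ1 : β < 1) : 0 < xbar α β :=
  div_pos (by linarith) (by linarith)

theorem xbar_mul (hβ1 : β < 1) : xbar α β * (1 - β) = 1 + α :=
  div_mul_cancel₀ _ (by linarith)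

theorem theta_sq (hα0 : 0 < α) (hβ0 : 0 ≤ β) (hβ1 : β < 1) :
    theta α β ^ 2 = 1 + 4 * xbar α β + 4 * β * xbar α β ^ 2 := by
  have := xbar_pos hα0 hβ1
  exact Real.sq_sqrt (by positivity)

theorem one_lt_theta (hα0 : 0 < α) (hβ0 : 0 ≤ β) (hβ1 : β < 1) : 1 < theta α β := by
  have := xbar_pos hα0 hβ1
  refine Real.lt_sqrt_of_sq_lt ?_
  have : 0 ≤ β * xbar α β ^ 2 := by positivity
  linarith

theorem xbar_mul_eigOne (hα0 : 0 < α) (hβ1 : β < 1) :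
    2 * xbar α β * eigOne α β = -1 - theta α β := by
  have := xbar_pos hα0 hβ1
  rw [eigOne]; field_simp

theorem xbar_mul_eigTwo (hα0 : 0 < α) (hβ1 : β < 1) :
    2 * xbar α β * eigTwo α β = -1 + theta α β := by
  have := xbar_pos hα0 hβ1
  rw [eigTwo]; field_simp

/-- Otherwise `θ ≤ 2X - 1`; squaring and using `X(1 - β) = 1 + α` would give `α ≥ 1`. -/
theorem eigOne_lt (hα0 : 0 < α) (hα1 : α < 1) (hβ0 : 0 ≤ β) (hβ1 : β < 1) :
    eigOne α β < -1 := by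
  have hX := xbar_pos hα0 hβ1
  have h1 := xbar_mul (α := α) hβ1
  have h2 := theta_sq hα0 hβ0 hβ1
  have h3 := one_lt_theta hα0 hβ0 hβ1
  rw [eigOne, div_lt_iff₀ (by positivity)]
  by_contra! h
  nlinarith [mul_pos hX (by linarith : 0 < 1 - α)]

theorem eigTwo_pos (hα0 : 0 < α) (hβ0 : 0 ≤ β) (hβ1 : β < 1) : 0 < eigTwo α β := by
  have hX := xbar_pos hα0 hβ1
  have h3 := one_lt_theta hα0 hβ0 hβ1
  exact div_pos (by linarith) (by linarith)

theorem eigTwo_lt (hα0 : 0 < α) (hβ0 : 0 ≤ β) (hβ1 : β < 1) :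
    eigTwo α β < 1 := by
  have hX := xbar_pos hα0 hβ1
  have h2 := theta_sq hα0 hβ0 hβ1
  have h3 := one_lt_theta hα0 hβ0 hβ1
  rw [eigTwo, div_lt_one (by positivity)]
  by_contra! h
  nlinarith [mul_pos (mul_pos hX hX) (by linarith : 0 < 1 - β)]

theorem eig_char (hα0 : 0 < α) (hβ0 : 0 ≤ β) (hβ1 : β < 1) (t : ℝ) :
    xbar α β * ((t - eigOne α β) * (t - eigTwo α β)) =
      xbar α β * t ^ 2 + t - (1 + β * xbar α β) := by
  have hX := xbar_pos hα0 hβ1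
  have h2 := theta_sq hα0 hβ0 hβ1
  rw [eigOne, eigTwo]
  field_simp
  linear_combination -h2

/-- The unstable eigen-coordinate. -/
noncomputable def coordOne (α β : ℝ) (p : ℝ × ℝ) : ℝ :=
  gammaOne α β * (p.1 - xbar α β) + gammaThree α β * (p.2 - xbar α β)

/-- The stable eigen-coordinate. -/
noncomputable def coordTwo (α β : ℝ) (p : ℝ × ℝ) : ℝ :=
  gammaTwo α β * (p.2 - xbar α β) - gammaOne α β * (p.1 - xbar α β)

/-- This is `θ² - 1 = 4X(1 + βX)`. It removes `β`, so that the coordinate changes become rational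
identities in `X` and `θ`. -/
theorem gammaOne_eq (hα0 : 0 < α) (hβ0 : 0 ≤ β) (hβ1 : β < 1) :
    gammaOne α β = -((theta α β - 1) * (theta α β + 1)) / (4 * xbar α β * theta α β) := by
  have hX := xbar_pos hα0 hβ1
  have h2 := theta_sq hα0 hβ0 hβ1
  have h3 := one_lt_theta hα0 hβ0 hβ1
  have : theta α β ≠ 0 := by linarith
  rw [gammaOne]
  field_simp
  linear_combination h2

theorem eigPoint_fst (ξ η : ℝ) : (eigPoint α β ξ η).1 =
    xbar α β + ξ * (-2 * xbar α β / (1 + theta α β))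
      + η * (-2 * xbar α β / (1 - theta α β)) := by
  simp [eigPoint, vecOne, vecTwo]

theorem eigPoint_snd (ξ η : ℝ) : (eigPoint α β ξ η).2 = xbar α β + ξ + η := by
  simp [eigPoint, vecOne, vecTwo]

theorem coordOne_eigPoint (hα0 : 0 < α) (hβ0 : 0 ≤ β) (hβ1 : β < 1) (ξ η : ℝ) :
    coordOne α β (eigPoint α β ξ η) = ξ := by
  have hX := xbar_pos hα0 hβ1
  have h3 := one_lt_theta hα0 hβ0 hβ1
  have h4 : 1 - theta α β ≠ 0 := by linarith
  have h5 : 1 + theta α β ≠ 0 := by linarith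
  have : theta α β ≠ 0 := by linarith
  rw [coordOne, eigPoint_fst, eigPoint_snd, gammaOne_eq hα0 hβ0 hβ1, gammaThree]
  field_simp
  ring

theorem coordTwo_eigPoint (hα0 : 0 < α) (hβ0 : 0 ≤ β) (hβ1 : β < 1) (ξ η : ℝ) :
    coordTwo α β (eigPoint α β ξ η) = η := by
  have hX := xbar_pos hα0 hβ1
  have h3 := one_lt_theta hα0 hβ0 hβ1
  have h4 : 1 - theta α β ≠ 0 := by linarith
  have h5 : 1 + theta α β ≠ 0 := by linarith
  have : theta α β ≠ 0 := by linarith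
  rw [coordTwo, eigPoint_fst, eigPoint_snd, gammaOne_eq hα0 hβ0 hβ1, gammaTwo]
  field_simp
  ring

theorem eigPoint_coord (hα0 : 0 < α) (hβ0 : 0 ≤ β) (hβ1 : β < 1) (p : ℝ × ℝ) :
    eigPoint α β (coordOne α β p) (coordTwo α β p) = p := by
  have hX := xbar_pos hα0 hβ1
  have h3 := one_lt_theta hα0 hβ0 hβ1
  have h4 : 1 - theta α β ≠ 0 := by linarith
  have h5 : 1 + theta α β ≠ 0 := by linarith
  have : theta α β ≠ 0 := by linarith
  ext
  · rw [eigPoint_fst, coordOne, coordTwo, gammaOne_eq hα0 hβ0 hβ1, gammaTwo, gammaThree]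
    field_simp
    ring
  · rw [eigPoint_snd, coordOne, coordTwo, gammaTwo, gammaThree]
    field_simp
    ring

/-- The map in eigen-coordinates. -/
noncomputable def normalForm (α β : ℝ) (z : ℝ × ℝ) : ℝ × ℝ :=
  (eigOne α β * z.1 + nfF α β z.1 z.2, eigTwo α β * z.2 + nfG α β z.1 z.2)

theorem ratMap_eigPoint (hα0 : 0 < α) (hβ0 : 0 ≤ β) (hβ1 : β < 1) {ξ η : ℝ}
    (h : ξ + η + xbar α β ≠ 0) :
    ratMap α β (eigPoint α β ξ η) =
      eigPoint α β (normalForm α β (ξ, η)).1 (normalForm α β (ξ, η)).2 := by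
  have hX := xbar_pos hα0 hβ1
  have hX1 := xbar_mul (α := α) hβ1
  have h2 := theta_sq hα0 hβ0 hβ1
  have h3 := one_lt_theta hα0 hβ0 hβ1
  have h4 : theta α β - 1 ≠ 0 := by linarith
  have h4' : 1 - theta α β ≠ 0 := by linarith
  have h5 : 1 + theta α β ≠ 0 := by linarith
  have h5' : theta α β + 1 ≠ 0 := by linarith
  have h6 : theta α β ≠ 0 := by linarith
  -- The fixed point equation eliminates `α` and the discriminant eliminates `β`, which leaves a
  -- rational identity in `X`, `θ`, `ξ`, `η` for the second component.
  have hα : α = xbar α β * (1 - β) - 1 := by linarith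
  have hβ : β = (theta α β ^ 2 - 1 - 4 * xbar α β) / (4 * xbar α β ^ 2) := by
    field_simp; linarith
  ext
  · simp only [ratMap]
    rw [eigPoint_fst, eigPoint_snd]
    simp only [normalForm, nfF, nfG, eigOne, eigTwo]
    generalize theta α β = θ at *
    generalize xbar α β = X at *
    have h4'' : 1 - θ = -(θ - 1) := by ring
    rw [h4'']
    field_simp
    ring
  · simp only [ratMap]
    rw [eigPoint_fst, eigPoint_snd, eigPoint_snd]
    simp only [normalForm, nfF, nfG, eigOne, eigTwo]
    generalize theta α β = θ at *
    generalize xbar α β = X at *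
    have h4'' : 1 - θ = -(θ - 1) := by ring
    have h' : X + ξ + η ≠ 0 := by convert h using 1; ring
    have h7 : ξ + η + X = X + ξ + η := by ring
    rw [h4'', h7]
    rw [hα]
    clear hα hX1
    subst hβ
    field_simp
    ring

/-- The curve `U = 0` is thus the graph of the cubic Taylor polynomial in eigen-coordinates, and can
be treated exactly like the graph of `φ`. -/
theorem cubicU_eq (p : ℝ × ℝ) :
    cubicU α β p.1 p.2 = -(coordTwo α β p - (coefTwo α β * coordOne α β p ^ 2
      + coefThree α β * coordOne α β p ^ 3)) := by
  simp only [cubicU, coordOne, coordTwo]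
  ring

theorem hasFDerivAt_ratMap {x y : ℝ} (hy : y ≠ 0) :
    HasFDerivAt (ratMap α β)
      ((ContinuousLinearMap.snd ℝ ℝ ℝ).prod
        ((β + 1 / y) • ContinuousLinearMap.fst ℝ ℝ ℝ
          - (x / y ^ 2) • ContinuousLinearMap.snd ℝ ℝ ℝ)) (x, y) := by
  refine HasFDerivAt.prodMk hasFDerivAt_snd ?_
  have h1 : HasFDerivAt (fun p : ℝ × ℝ => p.1) (ContinuousLinearMap.fst ℝ ℝ ℝ) (x, y) :=
    hasFDerivAt_fst
  have h2 : HasFDerivAt (fun p : ℝ × ℝ => p.2) (ContinuousLinearMap.snd ℝ ℝ ℝ) (x, y) :=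
    hasFDerivAt_snd
  have h3 := (h1.const_mul β).const_add α |>.add (h1.mul ((hasDerivAt_inv hy).comp_hasFDerivAt (x, y) h2))
  refine h3.congr_fderiv ?_
  ext
  · simp
  · simp
    field_simp

theorem isSaddle_ratMap (hα0 : 0 < α) (hα1 : α < 1) (hβ0 : 0 ≤ β) (hβ1 : β < 1) :
    IsSaddle (ratMap α β) (xbar α β, xbar α β)
      (eigOne α β) (vecOne α β) (eigTwo α β) (vecTwo α β) := by
  have hX := xbar_pos hα0 hβ1
  have hX1 := xbar_mul (α := α) hβ1
  have h2 := theta_sq hα0 hβ0 hβ1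
  have h3 := one_lt_theta hα0 hβ0 hβ1
  have hd := hasFDerivAt_ratMap (α := α) (β := β) (x := xbar α β) hX.ne'
  have h4 : 1 - theta α β ≠ 0 := by linarith
  have h5 : 1 + theta α β ≠ 0 := by linarith
  refine ⟨?_, hd.differentiableAt, ?_, ?_, ?_, ?_, ?_⟩
  · simp only [Function.IsFixedPt, ratMap, div_self hX.ne']
    ext <;> simp
    linarith
  · rw [hd.fderiv, Module.End.hasEigenvector_iff, Module.End.mem_eigenspace_iff]
    refine ⟨?_, fun h => by simpa [vecOne] using congrArg Prod.snd h⟩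
    ext
    · simp [vecOne, eigOne]
      field_simp
      ring
    · simp [vecOne, eigOne]
      field_simp
      linear_combination h2
  · rw [hd.fderiv, Module.End.hasEigenvector_iff, Module.End.mem_eigenspace_iff]
    refine ⟨?_, fun h => by simpa [vecTwo] using congrArg Prod.snd h⟩
    ext
    · simp [vecTwo, eigTwo]
      field_simp
      ring
    · simp [vecTwo, eigTwo]
      field_simp
      linear_combination h2
  · have := eigOne_lt hα0 hα1 hβ0 hβ1
    rw [abs_of_neg (by linarith)]; linarith
  · exact abs_pos.mpr (eigTwo_pos hα0 hβ0 hβ1).ne'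
  · rw [abs_of_pos (eigTwo_pos hα0 hβ0 hβ1)]; exact eigTwo_lt hα0 hβ0 hβ1

end Basic

/-! ### The unstable curve and the local unstable manifold -/

section Curve

variable {α β : ℝ}

theorem gammaTwo_pos (hα0 : 0 < α) (hβ0 : 0 ≤ β) (hβ1 : β < 1) : 0 < gammaTwo α β := by
  have := one_lt_theta hα0 hβ0 hβ1
  exact div_pos (by linarith) (by linarith)

/-- The stable coordinate annihilates the unstable direction `(1, λ₁)`. This gives both the tangency
of the curve and its slope over `x`. -/
theorem gammaTwo_mul_eigOne (hα0 : 0 < α) (hβ0 : 0 ≤ β) (hβ1 : β < 1) :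
    gammaTwo α β * eigOne α β = gammaOne α β := by
  have hX := xbar_pos hα0 hβ1
  have := one_lt_theta hα0 hβ0 hβ1
  have h : theta α β ≠ 0 := by linarith
  rw [gammaOne_eq hα0 hβ0 hβ1, gammaTwo, eigOne]
  field_simp
  ring

theorem gammaTwo_add_gammaThree (hα0 : 0 < α) (hβ0 : 0 ≤ β) (hβ1 : β < 1) :
    gammaTwo α β + gammaThree α β = 1 := by
  have := one_lt_theta hα0 hβ0 hβ1
  have h : theta α β ≠ 0 := by linarith
  rw [gammaTwo, gammaThree]
  field_simp
  ring

theorem eigPoint_zero : eigPoint α β 0 0 = (xbar α β, xbar α β) := by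
  simp [eigPoint]

theorem continuous_eigPoint : Continuous fun z : ℝ × ℝ => eigPoint α β z.1 z.2 := by
  unfold eigPoint
  fun_prop

/-- An analytic parametrization of the unstable curve, in eigen-coordinates, which conjugates the
map on the curve to the multiplication by the unstable eigenvalue. -/
theorem exists_parametrization (hα0 : 0 < α) (hα1 : α < 1) (hβ0 : 0 ≤ β) (hβ1 : β < 1) :
    ∃ a b : ℝ → ℝ, AnalyticAt ℝ a 0 ∧ AnalyticAt ℝ b 0 ∧ a 0 = 0 ∧ b 0 = 0 ∧
      HasDerivAt a (eigOne α β) 0 ∧ HasDerivAt b 0 0 ∧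
      ∀ᶠ s in 𝓝 (0 : ℝ), ratMap α β (eigPoint α β (a s) (b s)) =
        eigPoint α β (a (eigOne α β * s)) (b (eigOne α β * s)) := by
  have hX := xbar_pos hα0 hβ1
  have hX1 := xbar_mul (α := α) hβ1
  have hl := eigOne_lt hα0 hα1 hβ0 hβ1
  have hm0 := eigTwo_pos hα0 hβ0 hβ1
  have hm1 := eigTwo_lt hα0 hβ0 hβ1
  obtain ⟨w, hw, hw0, hw1, heq⟩ := exists_analytic_conjugacy (l := eigOne α β) (m := eigTwo α β)
    hX hβ0 hβ1 (by rw [abs_of_neg (by linarith)]; linarith) (by rwa [abs_of_pos hm0])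
    (eig_char hα0 hβ0 hβ1)
  have hg1 := gammaTwo_mul_eigOne hα0 hβ0 hβ1
  have hg2 := gammaTwo_add_gammaThree hα0 hβ0 hβ1
  set l := eigOne α β with hl_def
  set X := xbar α β with hX_def
  have hlin : AnalyticAt ℝ (fun s : ℝ => l * s) 0 := analyticAt_const.mul analyticAt_id
  have hwl : AnalyticAt ℝ (fun s => w (l * s)) 0 :=
    AnalyticAt.fun_comp (g := w) (f := fun s => l * s) (by simpa using hw) hlin
  have hwl1 : HasDerivAt (fun s => w (l * s)) l 0 := by
    have h1 : HasDerivAt (fun s : ℝ => l * s) l 0 := by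
      simpa using (hasDerivAt_id (0 : ℝ)).const_mul l
    have h2 : HasDerivAt w 1 (l * 0) := by simpa using hw1
    simpa using! h2.comp (0 : ℝ) h1
  -- Two consecutive terms of the orbit `X + w(lⁿ s)`; the functional equation for `w` says that the
  -- map sends `c s` to `c (l s)`.
  set c : ℝ → ℝ × ℝ := fun s => (X + w s, X + w (l * s)) with hc
  have hone : ∀ s, coordOne α β (c s) = gammaOne α β * w s + gammaThree α β * w (l * s) := by
    intro s; simp [coordOne, hc, ← hX_def]
  have htwo : ∀ s, coordTwo α β (c s) = gammaTwo α β * w (l * s) - gammaOne α β * w s := by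
    intro s; simp [coordTwo, hc, ← hX_def]
  refine ⟨fun s => coordOne α β (c s), fun s => coordTwo α β (c s), ?_, ?_, ?_, ?_, ?_, ?_, ?_⟩
  · simp only [hone]
    exact (analyticAt_const.mul hw).add (analyticAt_const.mul hwl)
  · simp only [htwo]
    exact (analyticAt_const.mul hwl).sub (analyticAt_const.mul hw)
  · simp [hone, hw0]
  · simp [htwo, hw0]
  · simp only [hone]
    convert! (hw1.const_mul (gammaOne α β)).add (hwl1.const_mul (gammaThree α β)) using 1
    linear_combination hg1 - l * hg2
  · simp only [htwo]
    convert! (hwl1.const_mul (gammaTwo α β)).sub (hw1.const_mul (gammaOne α β)) using 1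
    linear_combination -hg1
  · have hne : ∀ᶠ s in 𝓝 (0 : ℝ), X + w (l * s) ≠ 0 := by
      refine ContinuousAt.eventually_ne (continuousAt_const.add hwl.continuousAt) ?_
      simp [hw0, hX.ne']
    filter_upwards [heq, hne] with s hs hs0
    simp only [eigPoint_coord hα0 hβ0 hβ1]
    simp only [hc, ratMap]
    ext
    · rfl
    · simp only
      rw [show l * (l * s) = l ^ 2 * s by ring]
      field_simp
      linear_combination -hs - (X + w (l * s)) * hX1

/-- The common shape of `f` and `g`: the numerator vanishes to second order at the origin and the
denominator does not vanish there. -/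
theorem hasStrictFDerivAt_quadratic_div {A B K X : ℝ} (hK : K ≠ 0) (hX : X ≠ 0) :
    HasStrictFDerivAt (fun z : ℝ × ℝ =>
      (A * (z.1 + z.2) ^ 2 + B * (z.1 ^ 2 - z.2 ^ 2)) / (K * (z.1 + z.2 + X)))
      (0 : ℝ × ℝ →L[ℝ] ℝ) (0, 0) := by
  have h1 : HasStrictFDerivAt (fun p : ℝ × ℝ => p.1) (ContinuousLinearMap.fst ℝ ℝ ℝ) (0, 0) :=
    hasStrictFDerivAt_fst
  have h2 : HasStrictFDerivAt (fun p : ℝ × ℝ => p.2) (ContinuousLinearMap.snd ℝ ℝ ℝ) (0, 0) :=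
    hasStrictFDerivAt_snd
  have hN := (((h1.add h2).pow 2).const_mul A).add (((h1.pow 2).sub (h2.pow 2)).const_mul B)
  have hD := ((h1.add h2).add_const X).const_mul K
  have hD0 : K * ((0 : ℝ) + 0 + X) ≠ 0 := by simp [hK, hX]
  have hDi := (hasStrictDerivAt_inv hD0).comp_hasStrictFDerivAt ((0 : ℝ), (0 : ℝ)) hD
  refine (hN.mul hDi).congr_fderiv ?_
  ext <;> simp

theorem hasStrictFDerivAt_normalForm (hα0 : 0 < α) (hβ0 : 0 ≤ β) (hβ1 : β < 1) :
    HasStrictFDerivAt (normalForm α β)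
      ((eigOne α β • ContinuousLinearMap.fst ℝ ℝ ℝ).prod
        (eigTwo α β • ContinuousLinearMap.snd ℝ ℝ ℝ)) (0, 0) := by
  have hX := xbar_pos hα0 hβ1
  have ht := one_lt_theta hα0 hβ0 hβ1
  have h1 : HasStrictFDerivAt (fun p : ℝ × ℝ => p.1) (ContinuousLinearMap.fst ℝ ℝ ℝ) (0, 0) :=
    hasStrictFDerivAt_fst
  have h2 : HasStrictFDerivAt (fun p : ℝ × ℝ => p.2) (ContinuousLinearMap.snd ℝ ℝ ℝ) (0, 0) :=
    hasStrictFDerivAt_snd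
  have hf := hasStrictFDerivAt_quadratic_div (A := 1 + 2 * β * xbar α β) (B := theta α β)
    (K := theta α β * (theta α β - 1)) (mul_ne_zero (by linarith) (by linarith)) hX.ne'
  have hg := hasStrictFDerivAt_quadratic_div (A := 1 + 2 * β * xbar α β) (B := theta α β)
    (K := theta α β * (theta α β + 1)) (mul_ne_zero (by linarith) (by linarith)) hX.ne'
  refine HasStrictFDerivAt.prodMk ?_ ?_
  · exact ((h1.const_mul (eigOne α β)).add hf).congr_fderiv (by simp)
  · exact ((h2.const_mul (eigTwo α β)).add hg).congr_fderiv (by simp)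

theorem normalForm_zero : normalForm α β (0, 0) = (0, 0) := by
  simp [normalForm, nfF, nfG]

/-- A map which preserves the graph of `φ` and contracts to first order in the second direction
contracts the deviation from the graph. -/
theorem eventually_abs_deviation_le {S : ℝ × ℝ → ℝ × ℝ} {φ : ℝ → ℝ} {l m κ : ℝ}
    (hS : HasStrictFDerivAt S ((l • ContinuousLinearMap.fst ℝ ℝ ℝ).prod
      (m • ContinuousLinearMap.snd ℝ ℝ ℝ)) (0, 0)) (hS0 : S (0, 0) = (0, 0))
    (hφ : HasStrictDerivAt φ 0 0) (hφ0 : φ 0 = 0)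
    (hinv : ∀ᶠ ξ in 𝓝 (0 : ℝ), φ (S (ξ, φ ξ)).1 = (S (ξ, φ ξ)).2) (hm : |m| < κ) :
    ∀ᶠ z in 𝓝 ((0 : ℝ), (0 : ℝ)), |(S z).2 - φ (S z).1| ≤ κ * |z.2 - φ z.1| := by
  have hφ' : HasStrictFDerivAt φ (0 : ℝ →L[ℝ] ℝ) (S (0, 0)).1 := by
    rw [hS0]; simpa using! hφ.hasStrictFDerivAt
  have hG : HasStrictFDerivAt (fun z => (S z).2 - φ (S z).1)
      (m • ContinuousLinearMap.snd ℝ ℝ ℝ) (0, 0) := by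
    refine (hS.snd.sub (hφ'.comp ((0 : ℝ), (0 : ℝ)) hS.fst)).congr_fderiv ?_
    ext <;> simp
  -- The slack `κ - |m|` pays for the error in strict differentiability. The comparison point `(z.1,
  -- φ z.1)` lies on the graph, so by invariance its image has deviation zero.
  have hlip := hG.isLittleO.def (sub_pos.mpr hm)
  have ht : Tendsto (fun z : ℝ × ℝ => (z, (z.1, φ z.1))) (𝓝 (0, 0))
      (𝓝 (((0 : ℝ), (0 : ℝ)), ((0 : ℝ), (0 : ℝ)))) := by
    have h1 : ContinuousAt (fun z : ℝ × ℝ => φ z.1) (0, 0) :=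
      ContinuousAt.comp' (f := fun z : ℝ × ℝ => z.1) (g := φ) hφ.hasDerivAt.continuousAt
        continuousAt_fst
    have h2 : ContinuousAt (fun z : ℝ × ℝ => (z, (z.1, φ z.1))) (0, 0) :=
      continuousAt_id.prodMk (continuousAt_fst.prodMk h1)
    simpa [ContinuousAt, hφ0] using h2
  have hinv' : ∀ᶠ z in 𝓝 ((0 : ℝ), (0 : ℝ)), φ (S (z.1, φ z.1)).1 = (S (z.1, φ z.1)).2 :=
    (continuous_fst.tendsto ((0 : ℝ), (0 : ℝ))).eventually hinv
  filter_upwards [ht.eventually hlip, hinv'] with z hz hzi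
  have hnorm : ‖z - (z.1, φ z.1)‖ = |z.2 - φ z.1| := by
    simp [Prod.norm_def]
  rw [hnorm] at hz
  simp only [Real.norm_eq_abs, hzi, sub_self, sub_zero, FunLike.coe_smul, Pi.smul_apply,
    ContinuousLinearMap.coe_snd', Prod.snd_sub, smul_eq_mul] at hz
  have h1 := abs_sub_abs_le_abs_sub ((S z).2 - φ (S z).1) (m * (z.2 - φ z.1))
  rw [abs_mul] at h1
  linarith

theorem continuous_coordOne : Continuous (coordOne α β) := by
  unfold coordOne
  fun_prop

theorem continuous_coordTwo : Continuous (coordTwo α β) := by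
  unfold coordTwo
  fun_prop

theorem coordOne_fixed : coordOne α β (xbar α β, xbar α β) = 0 := by simp [coordOne]

theorem coordTwo_fixed : coordTwo α β (xbar α β, xbar α β) = 0 := by simp [coordTwo]

theorem injOn_ratMap (hβ0 : 0 ≤ β) : Set.InjOn (ratMap α β) {p | 0 < p.2} := by
  rintro ⟨x, y⟩ hy ⟨x', y'⟩ hy' h
  simp only [ratMap, Prod.mk.injEq, Set.mem_ofPred_eq] at *
  obtain ⟨rfl, h⟩ := h
  refine ⟨?_, rfl⟩
  have h1 : (β + 1 / y) * (x - x') = 0 := by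
    linear_combination h
  rcases mul_eq_zero.mp h1 with h2 | h2
  · have : 0 < 1 / y := by positivity
    linarith
  · linarith

/-- The unstable curve is an invariant analytic graph in eigen-coordinates, and it is the local
unstable manifold. -/
theorem exists_unstable_graph (hα0 : 0 < α) (hα1 : α < 1) (hβ0 : 0 ≤ β) (hβ1 : β < 1) :
    ∃ φ : ℝ → ℝ, AnalyticAt ℝ φ 0 ∧ φ 0 = 0 ∧ HasDerivAt φ 0 0 ∧
      (∀ᶠ ξ in 𝓝 (0 : ℝ),
        φ (eigOne α β * ξ + nfF α β ξ (φ ξ)) = eigTwo α β * φ ξ + nfG α β ξ (φ ξ)) ∧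
      ∃ N₀ ∈ 𝓝 (xbar α β, xbar α β), Set.InjOn (ratMap α β) N₀ ∧
        ∀ N ∈ 𝓝 (xbar α β, xbar α β), N ⊆ N₀ →
          ∀ᶠ p : ℝ × ℝ in 𝓝 (xbar α β, xbar α β),
            p ∈ localUnstable (ratMap α β) (xbar α β, xbar α β) N ↔
              coordTwo α β p = φ (coordOne α β p) := by
  have hX := xbar_pos hα0 hβ1
  have hl := eigOne_lt hα0 hα1 hβ0 hβ1
  have hm0 := eigTwo_pos hα0 hβ0 hβ1
  have hm1 := eigTwo_lt hα0 hβ0 hβ1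
  obtain ⟨a, b, ha, hb, ha0, hb0, ha1, hb1, hconj⟩ := exists_parametrization hα0 hα1 hβ0 hβ1
  have hda : deriv a 0 ≠ 0 := by rw [ha1.deriv]; linarith
  set σ := ha.hasStrictDerivAt.localInverse _ _ _ hda with hσ
  have hσan : AnalyticAt ℝ σ 0 := by
    have := ha.analyticAt_localInverse hda
    rwa [ha0] at this
  have hσleft : ∀ᶠ s in 𝓝 (0 : ℝ), σ (a s) = s :=
    HasStrictDerivAt.eventually_left_inverse ha.hasStrictDerivAt hda
  have hσright : ∀ᶠ ξ in 𝓝 (0 : ℝ), a (σ ξ) = ξ := by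
    have := HasStrictDerivAt.eventually_right_inverse ha.hasStrictDerivAt hda
    rwa [ha0] at this
  have hσ0 : σ 0 = 0 := by simpa [ha0] using hσleft.self_of_nhds
  have hσt : Tendsto σ (𝓝 0) (𝓝 0) := by
    simpa [ContinuousAt, hσ0] using hσan.continuousAt
  have hφan : AnalyticAt ℝ (fun ξ => b (σ ξ)) 0 :=
    AnalyticAt.fun_comp (g := b) (f := σ) (by rwa [hσ0]) hσan
  have hφ1 : HasDerivAt (fun ξ => b (σ ξ)) 0 0 := by
    have h1 : HasDerivAt b 0 (σ 0) := by rwa [hσ0]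
    simpa using! h1.comp (0 : ℝ) hσan.differentiableAt.hasDerivAt
  -- The inverse `σ` of the unstable coordinate `a` exists because `a'(0) = λ₁ ≠ 0`; the curve
  -- becomes a graph on taking `ξ = a(s)` as parameter.
  set φ := fun ξ => b (σ ξ) with hφ
  have hφ0 : φ 0 = 0 := by simp [hφ, hσ0, hb0]
  have hφt : Tendsto φ (𝓝 0) (𝓝 0) := by
    simpa [ContinuousAt, hφ0] using hφan.continuousAt
  have hlt : Tendsto (fun s : ℝ => eigOne α β * s) (𝓝 0) (𝓝 0) := by
    have : Continuous fun s : ℝ => eigOne α β * s := by fun_prop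
    simpa using this.tendsto 0
  have hφa : ∀ᶠ s in 𝓝 (0 : ℝ), φ (a s) = b s := by
    filter_upwards [hσleft] with s hs
    simp [hφ, hs]
  have hinv : ∀ᶠ ξ in 𝓝 (0 : ℝ),
      φ (normalForm α β (ξ, φ ξ)).1 = (normalForm α β (ξ, φ ξ)).2 := by
    have hne : ∀ᶠ ξ in 𝓝 (0 : ℝ), ξ + φ ξ + xbar α β ≠ 0 := by
      refine ContinuousAt.eventually_ne
        ((continuousAt_id.add hφan.continuousAt).add continuousAt_const) ?_
      simp [hφ0, hX.ne']
    filter_upwards [hσright, hne, hσt.eventually hconj, hσt.eventually (hlt.eventually hφa)]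
      with ξ h1 h2 h3 h4
    rw [h1] at h3
    have h5 := ratMap_eigPoint hα0 hβ0 hβ1 h2
    rw [h3] at h5
    have h6 := congrArg (coordOne α β) h5
    have h7 := congrArg (coordTwo α β) h5
    simp only [coordOne_eigPoint hα0 hβ0 hβ1, coordTwo_eigPoint hα0 hβ0 hβ1] at h6 h7
    rw [← h6, ← h7, h4]
  refine ⟨φ, hφan, hφ0, hφ1, hinv, ?_⟩
  -- The midpoint of `λ₂` and `1`: any rate strictly between them would serve.
  set κ := (1 + eigTwo α β) / 2 with hκ
  have hκ0 : 0 ≤ κ := by rw [hκ]; linarith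
  have hκ1 : κ < 1 := by rw [hκ]; linarith
  have hφs : HasStrictDerivAt φ 0 0 := by
    have := hφan.hasStrictDerivAt
    rwa [hφ1.deriv] at this
  have hcontr := eventually_abs_deviation_le (hasStrictFDerivAt_normalForm hα0 hβ0 hβ1)
    normalForm_zero hφs hφ0 hinv (κ := κ) (by rw [abs_of_pos hm0, hκ]; linarith)
  set h : ℝ × ℝ → ℝ := fun p => coordTwo α β p - φ (coordOne α β p) with hh
  set c := (xbar α β, xbar α β) with hc
  have hcoord : Tendsto (fun p => (coordOne α β p, coordTwo α β p)) (𝓝 c) (𝓝 (0, 0)) := by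
    have : Continuous fun p => (coordOne α β p, coordTwo α β p) :=
      continuous_coordOne.prodMk continuous_coordTwo
    simpa [hc, coordOne_fixed, coordTwo_fixed] using this.tendsto c
  have hone : Tendsto (coordOne α β) (𝓝 c) (𝓝 0) := by
    simpa [hc, coordOne_fixed] using (continuous_coordOne (α := α) (β := β)).tendsto c
  have hpos : ∀ᶠ p : ℝ × ℝ in 𝓝 c, 0 < p.2 :=
    (continuous_snd.tendsto c).eventually (lt_mem_nhds hX)
  have hdev : ∀ᶠ p in 𝓝 c, |h (ratMap α β p)| ≤ κ * |h p| := by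
    filter_upwards [hcoord.eventually hcontr, hpos] with p hp hp2
    have h1 := eigPoint_coord hα0 hβ0 hβ1 p
    have h2 : coordOne α β p + coordTwo α β p + xbar α β ≠ 0 := by
      have := congrArg Prod.snd h1
      rw [eigPoint_snd] at this
      linarith
    have h3 := ratMap_eigPoint hα0 hβ0 hβ1 h2
    rw [h1] at h3
    simp only [hh, h3, coordOne_eigPoint hα0 hβ0 hβ1, coordTwo_eigPoint hα0 hβ0 hβ1]
    exact hp
  have hht : Tendsto h (𝓝 c) (𝓝 0) := by
    have h1 : ContinuousAt φ (coordOne α β c) := by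
      rw [hc, coordOne_fixed]; exact hφan.continuousAt
    have h2 : ContinuousAt h c := continuous_coordTwo.continuousAt.sub
      (ContinuousAt.comp' (g := φ) (f := coordOne α β) h1 continuous_coordOne.continuousAt)
    have h3 : h c = 0 := by simp [hh, hc, coordOne_fixed, coordTwo_fixed, hφ0]
    simpa [ContinuousAt, h3] using h2
  -- The contraction is built into `N₀`, so it holds at every point of a backward orbit that stays
  -- in some `N ⊆ N₀`; positivity of `y` gives injectivity.
  refine ⟨{p | 0 < p.2 ∧ |h (ratMap α β p)| ≤ κ * |h p|}, hpos.and hdev,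
    (injOn_ratMap hβ0).mono fun p hp => hp.1, fun N hN hNN => ?_⟩
  have hcurve : Tendsto (fun s => eigPoint α β (a s) (b s)) (𝓝 0) (𝓝 c) := by
    have h1 : ContinuousAt (fun s => (a s, b s)) 0 := ha.continuousAt.prodMk hb.continuousAt
    have h2 := ContinuousAt.comp' (g := fun z : ℝ × ℝ => eigPoint α β z.1 z.2)
      continuous_eigPoint.continuousAt h1
    simpa [ContinuousAt, ha0, hb0, eigPoint_zero, hc] using h2
  obtain ⟨δ, hδ, hball⟩ := Metric.eventually_nhds_iff.mp (hconj.and (hcurve.eventually hN))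
  have hsmall : ∀ᶠ s in 𝓝 (0 : ℝ), dist s 0 < δ := Metric.ball_mem_nhds 0 hδ
  filter_upwards [hone.eventually hσright, hone.eventually (hσt.eventually hsmall)] with p hp1 hp2
  constructor
  · rintro ⟨q, rfl, hqN, hq, hqt⟩
    have hbound : ∀ n, |h (q 0)| ≤ κ ^ n * |h (q n)| := by
      intro n
      induction n with
      | zero => simp
      | succ n ih =>
        have := (hNN (hqN (n + 1))).2
        rw [hq n] at this
        calc |h (q 0)| ≤ κ ^ n * |h (q n)| := ih
          _ ≤ κ ^ n * (κ * |h (q (n + 1))|) := by gcongr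
          _ = _ := by ring
    have hlim : Tendsto (fun n => κ ^ n * |h (q n)|) atTop (𝓝 0) := by
      have := (tendsto_pow_atTop_nhds_zero_of_lt_one hκ0 hκ1).mul (hht.comp hqt).abs
      simpa using! this
    have : |h (q 0)| ≤ 0 := ge_of_tendsto' hlim hbound
    exact sub_eq_zero.mp (abs_nonpos_iff.mp this)
  · intro hp
    -- The parameter of `p` on the curve. Dividing it by powers of `λ₁` only shrinks it, so the
    -- backward orbit stays in the `δ`-range where the conjugacy holds and the curve lies in `N`.
    set t := σ (coordOne α β p) with ht
    have hpt : eigPoint α β (a t) (b t) = p := by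
      have hbt : b t = coordTwo α β p := hp.symm
      rw [hp1, hbt, eigPoint_coord hα0 hβ0 hβ1]
    have hl0 : eigOne α β ≠ 0 := by linarith
    have hli : |(eigOne α β)⁻¹| < 1 := by
      rw [abs_inv, abs_of_neg (by linarith)]
      exact inv_lt_one_of_one_lt₀ (by linarith)
    have hsm : ∀ n : ℕ, dist (t * (eigOne α β)⁻¹ ^ n) 0 < δ := by
      intro n
      refine lt_of_le_of_lt ?_ hp2
      rw [Real.dist_0_eq_abs, Real.dist_0_eq_abs, abs_mul, abs_pow]
      exact mul_le_of_le_one_right (abs_nonneg _) (pow_le_one₀ (abs_nonneg _) hli.le)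
    refine ⟨fun n => eigPoint α β (a (t * (eigOne α β)⁻¹ ^ n)) (b (t * (eigOne α β)⁻¹ ^ n)),
      by simpa using hpt, fun n => (hball (hsm n)).2, fun n => ?_, ?_⟩
    · have h1 := (hball (hsm (n + 1))).1
      have h2 : eigOne α β * (t * (eigOne α β)⁻¹ ^ (n + 1)) = t * (eigOne α β)⁻¹ ^ n := by
        rw [pow_succ]; field_simp
      rw [h1, h2]
    · have h1 : Tendsto (fun n : ℕ => t * (eigOne α β)⁻¹ ^ n) atTop (𝓝 0) := by
        simpa using (tendsto_pow_atTop_nhds_zero_of_abs_lt_one hli).const_mul t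
      exact hcurve.comp h1

end Curve

/-! ### Taylor coefficients of the invariant curve -/

theorem AnalyticAt.exists_eq_add_mul {f : ℝ → ℝ} (hf : AnalyticAt ℝ f 0) :
    ∃ g : ℝ → ℝ, AnalyticAt ℝ g 0 ∧ g 0 = deriv f 0 ∧ ∀ x, f x = f 0 + x * g x := by
  obtain ⟨p, hp⟩ := hf
  refine ⟨dslope f 0, ⟨_, hp.has_fpower_series_dslope_fslope⟩, dslope_same f 0, fun x => ?_⟩
  have := sub_smul_dslope f 0 x
  simp only [sub_zero, smul_eq_mul] at this
  linarith

/-- The second and third Taylor coefficients of an analytic invariant curve, through the equations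
which determine them. -/
theorem taylor_of_invariance {φ : ℝ → ℝ} {X A B K K' l m : ℝ} (hX : X ≠ 0) (hK : K ≠ 0)
    (hK' : K' ≠ 0) (hφ : AnalyticAt ℝ φ 0) (hφ0 : φ 0 = 0) (hφ1 : HasDerivAt φ 0 0)
    (hinv : ∀ᶠ ξ in 𝓝 (0 : ℝ),
      φ (l * ξ + (A * (ξ + φ ξ) ^ 2 + B * (ξ ^ 2 - φ ξ ^ 2)) / (K * (ξ + φ ξ + X))) =
        m * φ ξ + (A * (ξ + φ ξ) ^ 2 + B * (ξ ^ 2 - φ ξ ^ 2)) / (K' * (ξ + φ ξ + X))) :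
    ∃ b₂ b₃ : ℝ, l ^ 2 * b₂ = m * b₂ + (A + B) / (K' * X) ∧
      2 * l * ((A + B) / (K * X)) * b₂ + l ^ 3 * b₃ =
        m * b₃ + (2 * A * b₂ * X - (A + B)) / (K' * X ^ 2) ∧
      (fun ξ => φ ξ - (b₂ * ξ ^ 2 + b₃ * ξ ^ 3)) =O[𝓝 0] (fun ξ => ξ ^ 4) := by
  obtain ⟨χ, hχ, hχ0, hφχ⟩ := hφ.exists_eq_add_mul
  rw [hφ1.deriv] at hχ0
  obtain ⟨ψ, hψ, -, hχψ⟩ := hχ.exists_eq_add_mul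
  obtain ⟨ψ₁, hψ₁, hψ₁0, hψψ₁⟩ := hψ.exists_eq_add_mul
  obtain ⟨ψ₂, hψ₂, -, hψ₁ψ₂⟩ := hψ₁.exists_eq_add_mul
  have hsq : ∀ ξ, φ ξ = ξ ^ 2 * ψ ξ := by
    intro ξ
    rw [hφχ, hχψ, hφ0, hχ0]; ring
  -- Since `φ = ξ²ψ`, the wanted coefficients are the value and the derivative of `ψ` at the origin.
  -- The invariance equation divided by `ξ²` is then compared to first order only.
  set b₂ := ψ 0 with hb₂
  set b₃ := ψ₁ 0 with hb₃
  have hψd : HasDerivAt ψ b₃ 0 := by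
    rw [hψ₁0]; exact hψ.differentiableAt.hasDerivAt
  have hid := hasDerivAt_id' (0 : ℝ)
  have hM := (((hid.mul hψd).const_add 1).pow 2).const_mul A |>.add
    ((((hid.mul hψd).pow 2).const_sub 1).const_mul B)
  have hD := (hid.add ((hid.pow 2).mul hψd)).add_const X
  have hMD : ∀ k : ℝ, k ≠ 0 → HasDerivAt
      (fun ξ => (A * (1 + ξ * ψ ξ) ^ 2 + B * (1 - (ξ * ψ ξ) ^ 2)) / (k * (ξ + ξ ^ 2 * ψ ξ + X)))
      ((2 * A * b₂ * X - (A + B)) / (k * X ^ 2)) 0 := by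
    intro k hk
    have hD0 : k * ((0 : ℝ) + 0 ^ 2 * ψ 0 + X) ≠ 0 := by simp [hk, hX]
    convert! hM.div (hD.const_mul k) hD0 using 1
    simp [hb₂]
    field_simp
  have hQ := (hid.mul (hMD K hK)).const_add l
  have hξQ := hid.mul hQ
  set R : ℝ → ℝ := fun ξ =>
    (A * (1 + ξ * ψ ξ) ^ 2 + B * (1 - (ξ * ψ ξ) ^ 2)) / (K * (ξ + ξ ^ 2 * ψ ξ + X)) with hR
  set R' : ℝ → ℝ := fun ξ =>
    (A * (1 + ξ * ψ ξ) ^ 2 + B * (1 - (ξ * ψ ξ) ^ 2)) / (K' * (ξ + ξ ^ 2 * ψ ξ + X)) with hR'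
  have hR0 : R 0 = (A + B) / (K * X) := by simp [hR]
  have hR'0 : R' 0 = (A + B) / (K' * X) := by simp [hR']
  have hcomp : HasDerivAt (fun ξ => ψ (ξ * (l + ξ * R ξ))) (b₃ * l) 0 := by
    have h1 : HasDerivAt ψ b₃ (0 * (l + 0 * R 0)) := by simpa using hψd
    have h2 := h1.comp (0 : ℝ) hξQ
    simpa using! h2
  have hleft : HasDerivAt (fun ξ => (l + ξ * R ξ) ^ 2 * ψ (ξ * (l + ξ * R ξ)))
      (2 * l * ((A + B) / (K * X)) * b₂ + l ^ 3 * b₃) 0 := by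
    convert! (hQ.pow 2).mul hcomp using 1
    simp [hR0, hb₂]
    ring
  have hright : HasDerivAt (fun ξ => m * ψ ξ + R' ξ)
      (m * b₃ + (2 * A * b₂ * X - (A + B)) / (K' * X ^ 2)) 0 :=
    (hψd.const_mul m).add (hMD K' hK')
  -- The division by `ξ²` needs `ξ ≠ 0`; continuity of both sides then extends the equality to the
  -- origin.
  have hpunct : (fun ξ => (l + ξ * R ξ) ^ 2 * ψ (ξ * (l + ξ * R ξ))) =ᶠ[𝓝[≠] 0]
      fun ξ => m * ψ ξ + R' ξ := by
    filter_upwards [hinv.filter_mono nhdsWithin_le_nhds, self_mem_nhdsWithin] with ξ hξ hξ0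
    have hξ0 : ξ ≠ 0 := hξ0
    have hnum : A * (ξ + φ ξ) ^ 2 + B * (ξ ^ 2 - φ ξ ^ 2) =
        ξ ^ 2 * (A * (1 + ξ * ψ ξ) ^ 2 + B * (1 - (ξ * ψ ξ) ^ 2)) := by
      rw [hsq]; ring
    have harg : l * ξ + (A * (ξ + φ ξ) ^ 2 + B * (ξ ^ 2 - φ ξ ^ 2)) / (K * (ξ + φ ξ + X)) =
        ξ * (l + ξ * R ξ) := by
      rw [hnum, hsq, hR]; ring
    have hval : (A * (ξ + φ ξ) ^ 2 + B * (ξ ^ 2 - φ ξ ^ 2)) / (K' * (ξ + φ ξ + X)) =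
        ξ ^ 2 * R' ξ := by
      rw [hnum, hsq, hR']; ring
    rw [harg, hval, hsq, hsq ξ] at hξ
    have : ξ ^ 2 ≠ 0 := pow_ne_zero 2 hξ0
    apply mul_left_cancel₀ this
    linear_combination hξ
  have hev := (hleft.continuousAt.eventuallyEq_nhds_iff_eventuallyEq_nhdsNE
    hright.continuousAt).mp hpunct
  refine ⟨b₂, b₃, ?_, hleft.unique (hright.congr_of_eventuallyEq hev), ?_⟩
  · have := hev.self_of_nhds
    simpa [hR'0] using this
  · have hb : ψ₂ =O[𝓝 0] (fun _ => (1 : ℝ)) := hψ₂.continuousAt.isBigO_one ℝ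
    have := (isBigO_refl (fun ξ : ℝ => ξ ^ 4) (𝓝 0)).mul hb
    refine (this.congr (fun ξ => ?_) fun ξ => by ring)
    rw [hsq, hψψ₁, hψ₁ψ₂]
    ring

/-! ### The two coefficients, and graphs over the first coordinate -/

section Graph

variable {α β : ℝ}

theorem taylor_unstable_graph (hα0 : 0 < α) (hα1 : α < 1) (hβ0 : 0 ≤ β) (hβ1 : β < 1)
    {φ : ℝ → ℝ} (hφ : AnalyticAt ℝ φ 0) (hφ0 : φ 0 = 0) (hφ1 : HasDerivAt φ 0 0)
    (hinv : ∀ᶠ ξ in 𝓝 (0 : ℝ),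
        φ (eigOne α β * ξ + nfF α β ξ (φ ξ)) = eigTwo α β * φ ξ + nfG α β ξ (φ ξ)) :
    (fun ξ => φ ξ - (coefTwo α β * ξ ^ 2 + coefThree α β * ξ ^ 3))
        =O[𝓝 0] (fun ξ => ξ ^ 4) := by
  have hX := xbar_pos hα0 hβ1
  have ht := one_lt_theta hα0 hβ0 hβ1
  have hl := eigOne_lt hα0 hα1 hβ0 hβ1
  have hm0 := eigTwo_pos hα0 hβ0 hβ1
  have hm1 := eigTwo_lt hα0 hβ0 hβ1
  have ht0 : theta α β ≠ 0 := by linarith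
  have ht1 : theta α β - 1 ≠ 0 := by linarith
  have ht2 : theta α β + 1 ≠ 0 := by linarith
  obtain ⟨b₂, b₃, h₂, h₃, hO⟩ := taylor_of_invariance hX.ne' (mul_ne_zero ht0 ht1)
    (mul_ne_zero ht0 ht2) hφ hφ0 hφ1 hinv
  have e1 : theta α β + 1 = -(2 * xbar α β * eigOne α β) := by
    rw [xbar_mul_eigOne hα0 hβ1]; ring
  have e2 : theta α β - 1 = 2 * xbar α β * eigTwo α β := by
    rw [xbar_mul_eigTwo hα0 hβ1]; ring
  have hl0 : eigOne α β ≠ 0 := by linarith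
  have hd2 : eigOne α β ^ 2 - eigTwo α β ≠ 0 := by nlinarith
  have hd3 : eigOne α β ^ 3 - eigTwo α β ≠ 0 := by nlinarith [sq_nonneg (eigOne α β)]
  have hb₂ : b₂ = coefTwo α β := by
    rw [coefTwo]
    field_simp at h₂ ⊢
    linear_combination h₂
  have hb₃ : b₃ = coefThree α β := by
    rw [coefThree, ← hb₂]
    rw [e1] at h₂ h₃
    rw [e2] at h₃
    generalize eigOne α β = l at *
    generalize eigTwo α β = m at *
    generalize theta α β = θ at *
    generalize xbar α β = X at *
    have hm : m ≠ 0 := hm0.ne'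
    have hAB : 1 + 2 * β * X + θ = -(2 * X * l) * θ * X * (l ^ 2 - m) * b₂ := by
      field_simp at h₂
      linear_combination h₂
    generalize 1 + 2 * β * X = A at *
    -- The second-order equation turns the inhomogeneous term of the third-order one into a multiple
    -- of `b₂`, which explains the factor `a₂` in `a₃`.
    have hW : (A + θ) / (θ * (2 * X * l) * X ^ 2) = -(l ^ 2 - m) * b₂ / X := by
      rw [hAB]; field_simp
    have h₃' : (l ^ 3 - m) * b₃ = -(2 * l * ((A + θ) / (θ * (2 * X * m) * X)) * b₂)
        - 2 * A * b₂ * X / (θ * (2 * X * l) * X ^ 2) + (A + θ) / (θ * (2 * X * l) * X ^ 2) := by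
      rw [mul_neg, neg_mul, div_neg, sub_div] at h₃
      linear_combination h₃
    rw [hW] at h₃'
    apply mul_left_cancel₀ hd3
    rw [h₃']
    field_simp
    ring
  rw [← hb₂, ← hb₃]
  exact hO

theorem hasStrictFDerivAt_graph {ψ : ℝ → ℝ} (hψ : HasStrictDerivAt ψ 0 0) :
    HasStrictFDerivAt (fun p => coordTwo α β p - ψ (coordOne α β p))
      (gammaTwo α β • ContinuousLinearMap.snd ℝ ℝ ℝ
        - gammaOne α β • ContinuousLinearMap.fst ℝ ℝ ℝ) (xbar α β, xbar α β) := by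
  have h1 : HasStrictFDerivAt (fun p : ℝ × ℝ => p.1 - xbar α β) (ContinuousLinearMap.fst ℝ ℝ ℝ)
      (xbar α β, xbar α β) := hasStrictFDerivAt_fst.sub_const _
  have h2 : HasStrictFDerivAt (fun p : ℝ × ℝ => p.2 - xbar α β) (ContinuousLinearMap.snd ℝ ℝ ℝ)
      (xbar α β, xbar α β) := hasStrictFDerivAt_snd.sub_const _
  have hone : HasStrictFDerivAt (coordOne α β) _ (xbar α β, xbar α β) :=
    (h1.const_mul (gammaOne α β)).add (h2.const_mul (gammaThree α β))
  have htwo : HasStrictFDerivAt (coordTwo α β) _ (xbar α β, xbar α β) :=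
    (h2.const_mul (gammaTwo α β)).sub (h1.const_mul (gammaOne α β))
  have hψ' : HasStrictFDerivAt ψ (0 : ℝ →L[ℝ] ℝ) (coordOne α β (xbar α β, xbar α β)) := by
    rw [coordOne_fixed]; simpa using! hψ.hasStrictFDerivAt
  refine (htwo.sub (hψ'.comp (xbar α β, xbar α β) hone)).congr_fderiv ?_
  simp

/-- A curve tangent to the unstable direction is a graph over the first coordinate. -/
theorem exists_graph_over_fst (hα0 : 0 < α) (hβ0 : 0 ≤ β) (hβ1 : β < 1) {ψ : ℝ → ℝ}
    (hψ0 : ψ 0 = 0) (hψ : HasStrictDerivAt ψ 0 0) :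
    ∃ Ψ : ℝ → ℝ, (∀ᶠ p : ℝ × ℝ in 𝓝 (xbar α β, xbar α β),
        coordTwo α β p = ψ (coordOne α β p) ↔ p.2 = Ψ p.1) ∧
      Ψ (xbar α β) = xbar α β ∧ HasDerivAt Ψ (eigOne α β) (xbar α β) := by
  have hg := gammaTwo_pos hα0 hβ0 hβ1
  have hf := hasStrictFDerivAt_graph (α := α) (β := β) hψ
  set f := fun p => coordTwo α β p - ψ (coordOne α β p) with hfdef
  set c := (xbar α β, xbar α β) with hc
  have hfc : f c = 0 := by simp [hfdef, hc, coordOne_fixed, coordTwo_fixed, hψ0]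
  -- The partial derivative of `f` in `y` is `γ₂ > 0`, as the implicit function theorem requires.
  have hi : ((gammaTwo α β • ContinuousLinearMap.snd ℝ ℝ ℝ
        - gammaOne α β • ContinuousLinearMap.fst ℝ ℝ ℝ) ∘L
          ContinuousLinearMap.inr ℝ ℝ ℝ).IsInvertible := by
    refine ⟨ContinuousLinearEquiv.unitsEquivAut ℝ (Units.mk0 _ hg.ne'), ?_⟩
    ext
    simp
  set Ψ := hf.implicitFunctionOfProdDomain hi with hΨ
  have hiff := hf.eventually_apply_eq_iff_implicitFunctionOfProdDomain hi
  have hd := (hf.hasStrictFDerivAt_implicitFunctionOfProdDomain hi).hasFDerivAt.differentiableAt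
  have happ := hf.eventually_apply_implicitFunctionOfProdDomain hi
  rw [← hΨ] at hiff hd happ
  have hΨc : Ψ (xbar α β) = xbar α β := hiff.self_of_nhds.mp rfl
  refine ⟨Ψ, ?_, hΨc, ?_⟩
  · filter_upwards [hiff] with p hp
    rw [hfc] at hp
    rw [← sub_eq_zero, eq_comm (a := p.2)]
    exact hp
  -- Differentiating the constant `f(x, Ψ x)` gives `γ₂ Ψ' = γ₁ = γ₂ λ₁`.
  · have hd' : HasDerivAt Ψ (deriv Ψ (xbar α β)) (xbar α β) := DifferentiableAt.hasDerivAt hd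
    have hgr : HasDerivAt (fun x => (x, Ψ x)) (1, deriv Ψ (xbar α β)) (xbar α β) :=
      (hasDerivAt_id' _).prodMk hd'
    have hf' := hf.hasFDerivAt
    rw [show c = (xbar α β, Ψ (xbar α β)) by rw [hΨc]] at hf'
    have hcomp := hf'.comp_hasDerivAt (xbar α β) hgr
    have hconst : HasDerivAt (f ∘ fun x => (x, Ψ x)) 0 (xbar α β) :=
      (hasDerivAt_const (xbar α β) (f c)).congr_of_eventuallyEq happ
    have := hcomp.unique hconst
    simp only [FunLike.coe_sub, Pi.sub_apply, FunLike.coe_smul, Pi.smul_apply,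
      ContinuousLinearMap.coe_snd', ContinuousLinearMap.coe_fst', smul_eq_mul, mul_one] at this
    rw [← gammaTwo_mul_eigOne hα0 hβ0 hβ1, ← mul_sub] at this
    rcases mul_eq_zero.mp this with h | h
    · exact absurd h hg.ne'
    · rwa [sub_eq_zero.mp h] at hd'

/-- Two curves tangent to the unstable direction have the same order of contact over the first
coordinate as in eigen-coordinates. -/
theorem graph_sub_graph_isBigO (hα0 : 0 < α) (hβ0 : 0 ≤ β) (hβ1 : β < 1)
    {φ ψ Φ Ψ : ℝ → ℝ} {n : ℕ} (hψ : HasStrictDerivAt ψ 0 0)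
    (hO : (fun ξ => φ ξ - ψ ξ) =O[𝓝 0] fun ξ => ξ ^ n)
    (hΦ : ∀ᶠ p : ℝ × ℝ in 𝓝 (xbar α β, xbar α β),
        coordTwo α β p = φ (coordOne α β p) ↔ p.2 = Φ p.1)
    (hΨ : ∀ᶠ p : ℝ × ℝ in 𝓝 (xbar α β, xbar α β),
        coordTwo α β p = ψ (coordOne α β p) ↔ p.2 = Ψ p.1)
    (hΦc : Φ (xbar α β) = xbar α β) (hΨc : Ψ (xbar α β) = xbar α β)
    (hΦd : DifferentiableAt ℝ Φ (xbar α β)) (hΨd : ContinuousAt Ψ (xbar α β)) :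
    (fun x => Φ x - Ψ x) =O[𝓝 (xbar α β)] fun x => (x - xbar α β) ^ n := by
  have hg := gammaTwo_pos hα0 hβ0 hβ1
  set f := fun p => coordTwo α β p - ψ (coordOne α β p) with hfdef
  have hf := hasStrictFDerivAt_graph (α := α) (β := β) hψ
  rw [← hfdef] at hf
  have htΦ : Tendsto (fun x => (x, Φ x)) (𝓝 (xbar α β)) (𝓝 (xbar α β, xbar α β)) := by
    have : ContinuousAt (fun x => (x, Φ x)) (xbar α β) := continuousAt_id.prodMk hΦd.continuousAt
    simpa [ContinuousAt, hΦc] using this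
  have htΨ : Tendsto (fun x => (x, Ψ x)) (𝓝 (xbar α β)) (𝓝 (xbar α β, xbar α β)) := by
    have : ContinuousAt (fun x => (x, Ψ x)) (xbar α β) := continuousAt_id.prodMk hΨd
    simpa [ContinuousAt, hΨc] using this
  have hcoord : (fun x => coordOne α β (x, Φ x)) =O[𝓝 (xbar α β)] fun x => x - xbar α β := by
    have h1 := hΦd.hasFDerivAt.isBigO_sub
    rw [hΦc] at h1
    exact ((isBigO_refl _ _).const_mul_left _).add (h1.const_mul_left _)
  have hone : Tendsto (fun x => coordOne α β (x, Φ x)) (𝓝 (xbar α β)) (𝓝 0) := by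
    have := ((continuous_coordOne (α := α) (β := β)).tendsto (xbar α β, xbar α β)).comp htΦ
    rwa [coordOne_fixed] at this
  -- On the graph of `Φ` one has `f = φ(ξ) - ψ(ξ)`, and `ξ = O(x - X)` there.
  have hfΦ : (fun x => f (x, Φ x)) =O[𝓝 (xbar α β)] fun x => (x - xbar α β) ^ n := by
    refine ((hO.comp_tendsto hone).trans (hcoord.pow n)).congr' ?_ EventuallyEq.rfl
    filter_upwards [htΦ.eventually hΦ] with x hx
    simp only [Function.comp, hfdef]
    rw [hx.mpr rfl]
  have hfΨ : ∀ᶠ x in 𝓝 (xbar α β), f (x, Ψ x) = 0 := by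
    filter_upwards [htΨ.eventually hΨ] with x hx
    exact sub_eq_zero.mpr (hx.mpr rfl)
  -- With error `γ₂/2` in the strict derivative, the two points over the same `x` satisfy `γ₂|Φ - Ψ|
  -- ≤ |f(x, Φ)| + (γ₂/2)|Φ - Ψ|`, because `f(x, Ψ) = 0`.
  have hbound := (htΦ.prodMk_nhds htΨ).eventually (hf.isLittleO.def (half_pos hg))
  refine IsBigO.trans (IsBigO.of_bound (2 / gammaTwo α β) ?_) hfΦ
  filter_upwards [hbound, hfΨ] with x h1 h2
  have hnorm : ‖(x, Φ x) - (x, Ψ x)‖ = |Φ x - Ψ x| := by simp [Prod.norm_def]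
  rw [hnorm] at h1
  simp only [h2, sub_zero, Prod.mk_sub_mk, sub_self, FunLike.coe_sub, Pi.sub_apply,
    FunLike.coe_smul, Pi.smul_apply, ContinuousLinearMap.coe_snd', ContinuousLinearMap.coe_fst',
    smul_eq_mul, mul_zero, Real.norm_eq_abs] at h1
  have h3 := abs_sub_abs_le_abs_sub (gammaTwo α β * (Φ x - Ψ x)) (f (x, Φ x))
  rw [abs_sub_comm _ (f (x, Φ x)), abs_mul, abs_of_pos hg] at h3
  rw [Real.norm_eq_abs, Real.norm_eq_abs, div_mul_eq_mul_div, le_div_iff₀ hg]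
  linarith

end Graph

/-! ### The main theorem -/

theorem theorem4 (α β : ℝ) (hα0 : 0 < α) (hα1 : α < 1) (hβ0 : 0 ≤ β) (hβ1 : β < 1) :
    -- the fixed point is a saddle
    IsSaddle (ratMap α β) (xbar α β, xbar α β)
      (eigOne α β) (vecOne α β) (eigTwo α β) (vecTwo α β) ∧
    ∃ φ Φ φt : ℝ → ℝ,
      -- the local unstable manifold is the graph of `φ` in eigen-coordinates and of `Φ` in the
      -- coordinates `(x, y) = (x_{n-1}, x_n)`
      (∃ N₀ ∈ 𝓝 (xbar α β, xbar α β), Set.InjOn (ratMap α β) N₀ ∧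
        ∀ N ∈ 𝓝 (xbar α β, xbar α β), N ⊆ N₀ →
          (∀ᶠ z : ℝ × ℝ in 𝓝 (0, 0),
            eigPoint α β z.1 z.2 ∈ localUnstable (ratMap α β) (xbar α β, xbar α β) N ↔
              z.2 = φ z.1) ∧
          (∀ᶠ p : ℝ × ℝ in 𝓝 (xbar α β, xbar α β),
            p ∈ localUnstable (ratMap α β) (xbar α β, xbar α β) N ↔ p.2 = Φ p.1)) ∧
      -- `φ` is analytic, solves the invariance equation, and has the stated Taylor expansion
      AnalyticAt ℝ φ 0 ∧ φ 0 = 0 ∧ HasDerivAt φ 0 0 ∧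
      (∀ᶠ ξ in 𝓝 (0 : ℝ),
        φ (eigOne α β * ξ + nfF α β ξ (φ ξ)) = eigTwo α β * φ ξ + nfG α β ξ (φ ξ)) ∧
      (fun ξ => φ ξ - (coefTwo α β * ξ ^ 2 + coefThree α β * ξ ^ 3))
        =O[𝓝 0] (fun ξ => ξ ^ 4) ∧
      -- near the fixed point the curve `U = 0` is the graph of `φt`
      (∀ᶠ p : ℝ × ℝ in 𝓝 (xbar α β, xbar α β), cubicU α β p.1 p.2 = 0 ↔ p.2 = φt p.1) ∧
      φt (xbar α β) = xbar α β ∧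
      HasDerivAt φt (-(1 + theta α β) / (2 * xbar α β)) (xbar α β) ∧
      -- the two curves agree up to and including third order
      (fun x => Φ x - φt x) =O[𝓝 (xbar α β)] (fun x => (x - xbar α β) ^ 4) := by

  refine ⟨isSaddle_ratMap hα0 hα1 hβ0 hβ1, ?_⟩
  obtain ⟨φ, hφ, hφ0, hφ1, hinv, N₀, hN₀, hinj, hW⟩ := exists_unstable_graph hα0 hα1 hβ0 hβ1
  have hO := taylor_unstable_graph hα0 hα1 hβ0 hβ1 hφ hφ0 hφ1 hinv
  have hφs : HasStrictDerivAt φ 0 0 := by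
    have := hφ.hasStrictDerivAt
    rwa [hφ1.deriv] at this
  have hcs : HasStrictDerivAt
      (fun ξ : ℝ => coefTwo α β * ξ ^ 2 + coefThree α β * ξ ^ 3) 0 0 := by
    have hid := hasStrictDerivAt_id (0 : ℝ)
    simpa using! ((hid.pow 2).const_mul (coefTwo α β)).add ((hid.pow 3).const_mul (coefThree α β))
  obtain ⟨Φ, hΦ, hΦc, hΦd⟩ := exists_graph_over_fst hα0 hβ0 hβ1 hφ0 hφs
  obtain ⟨φt, hφt, hφtc, hφtd⟩ := exists_graph_over_fst hα0 hβ0 hβ1 (by simp) hcs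
  refine ⟨φ, Φ, φt, ⟨N₀, hN₀, hinj, fun N hN hNN => ⟨?_, ?_⟩⟩, hφ, hφ0, hφ1, hinv, hO, ?_, hφtc,
    ?_, graph_sub_graph_isBigO hα0 hβ0 hβ1 hcs hO hΦ hφt hΦc hφtc hΦd.differentiableAt
      hφtd.continuousAt⟩
  · have ht : Tendsto (fun z : ℝ × ℝ => eigPoint α β z.1 z.2) (𝓝 (0, 0))
        (𝓝 (xbar α β, xbar α β)) := by
      have := (continuous_eigPoint (α := α) (β := β)).tendsto (0, 0)
      rwa [eigPoint_zero] at this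
    filter_upwards [ht.eventually (hW N hN hNN)] with z hz
    rwa [coordOne_eigPoint hα0 hβ0 hβ1, coordTwo_eigPoint hα0 hβ0 hβ1] at hz
  · filter_upwards [hW N hN hNN, hΦ] with p h1 h2
    exact h1.trans h2
  · filter_upwards [hφt] with p hp
    rw [cubicU_eq, neg_eq_zero, sub_eq_zero]
    exact hp
  · convert! hφtd using 1
    rw [eigOne]
    ring
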